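/- Let $A$ be a finite alphabet. A two-dimensional pattern is a map $p\colon P\to A$ with $P\subset\mathbb Z^2$ finite. A set $\mathcal F$ of patterns defines the subshift $X_{\mathcal F}\subseteq A^{\mathbb Z^2}$ of all configurations $x$ in which no $p\in\mathcal F$ occurs, that is, for no $p\colon P\to A$ in $\mathcal F$ and no $z\in\mathbb Z^2$ do we have $x_{z+h}=p(h)$ for all $h\in P$. A two-dimensional subshift is effective if it equals $X_{\mathcal F}$ for some computable (equivalently, computably enumerable) set $\mathcal F$ of patterns, and of finite type (an SFT) if it equals $X_{\mathcal F}$ for some finite $\mathcal F$. Let $0'$ be the Turing degree of the halting problem. Corollary. Let $X\subseteq A^{\mathbb Z^2}$ be a non-empty two-dimensional effective subshift (in particular, any non-empty two-dimensional SFT) that has no computable point. Then for every Turing degree $d\ge 0'$ (where a Turing degree is the degree of a sequence in $\{0,1\}^{\mathbb N}$) there is a point $x\in X$ of Turing degree exactly $d$. -/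

import Mathlib

open SymbolicDynamics.FullShift

/-- The Turing degree of a total map between encoded types (a 0-1 sequence, a two-dimensional
configuration, a decision problem): the degree of the corresponding total function `ℕ → ℕ`. -/
def turingDegree {α β : Type*} [Denumerable α] [Encodable β] (f : α → β) : TuringDegree :=
  toAntisymmetrization TuringReducible
    (fun n : ℕ => Part.some (Encodable.encode (f (Denumerable.ofNat α n))))

open Classical in
/-- The halting problem: does the program `q.1` halt on the input `q.2`?  Its degree is `0'`. -/
noncomputable def haltingProblem (q : Nat.Partrec.Code × ℕ) : Bool :=
  decide (q.1.eval q.2).Dom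

/-- The finite list `l` of pairs (position, letter) enumerates the graph of the two-dimensional
pattern `p : P → A`, in any order and possibly with repetitions. -/
def EnumeratesPattern {A : Type*} [Inhabited A] (l : List ((ℤ × ℤ) × A)) (p : Pattern A (ℤ × ℤ)) : Prop :=
  ∀ (z : ℤ × ℤ) (a : A), (z, a) ∈ l ↔ z ∈ p.support ∧ p.config z = a

/-- A set of finite patterns is computably enumerable. Every computable set of patterns is. -/
def IsCEPatternSet {A : Type*} [Inhabited A] [Primcodable A]
    (F : Set (Pattern A (ℤ × ℤ))) : Prop :=
  REPred fun l : List ((ℤ × ℤ) × A) => ∃ p ∈ F, EnumeratesPattern l p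

/-- An effective subshift is one defined by a computable or, equivalently, by a computably
enumerable set of forbidden patterns. -/
def IsEffectiveSubshift {A : Type*} [Inhabited A] [Primcodable A] [TopologicalSpace A]
    [DiscreteTopology A] (X : Subshift A (ℤ × ℤ)) : Prop :=
  ∃ F : Set (Pattern A (ℤ × ℤ)), IsCEPatternSet F ∧ X = Subshift.ofForbidden F

/-- A subshift of finite type is one defined by a finite set of forbidden patterns. -/
def IsSFT {A : Type*} [Inhabited A] [TopologicalSpace A] [DiscreteTopology A]
    (X : Subshift A (ℤ × ℤ)) : Prop :=
  ∃ F : Set (Pattern A (ℤ × ℤ)), F.Finite ∧ X = Subshift.ofForbidden F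

/-! Number the cells of `ℤ × ℤ` by their codes: configurations become sequences, and words are
patterns on initial sets of cells. The points of the subshift are then the branches of a primitive
recursive tree (`exists_shiftTree`). Run through all words and forbid each one whose removal leaves
some point; what remains is a minimal subsystem. By compactness, emptiness shows at a finite level,
so it is semidecidable, and `0'` computes the language of the subsystem (`computableIn_inLanguage`).

A sequence `s` is coded by a point `y` of the subsystem, built letter by letter inside the language.
While a bit of `s` is being coded, each letter is the first admissible one in a fixed order of the
alphabet or in the opposite order, according to the bit. Suppose that a translate of `y` agrees with
`y` before the cell `z` and differs from it at `z`. Both letters are admissible after the common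
prefix, so comparing them reveals the bit under which `y z` was chosen (`letterBit_codingSeq`). The
next bit starts once the prefix shows such a pair with `z` chosen during the current bit.

Such a pair always appears (`exists_hasBranch`). Otherwise every return of the prefix present at the
start of the bit is a period; returns have bounded gaps, so `y` is doubly periodic, hence
computable, which is excluded. Thus `s` together with `0'` computes `y` (`computableIn_codingSeq`),
while `y` alone computes `s` (`computableIn_of_codingSeq`). -/

/-! ### Closure properties of relative computability. -/

namespace ComputableIn

open Encodable

variable {α β γ σ : Type*} [Primcodable α] [Primcodable β] [Primcodable γ] [Primcodable σ]
variable {O : Set (ℕ →. ℕ)}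

theorem of_eq {f g : α → σ} (hf : ComputableIn O f) (H : ∀ a, f a = g a) : ComputableIn O g :=
  (funext H : f = g) ▸ hf

theorem comp {f : β → σ} {g : α → β} (hf : ComputableIn O f) (hg : ComputableIn O g) :
    ComputableIn O fun a => f (g a) :=
  (Nat.RecursiveIn.comp hf hg).of_eq fun n => by
    rcases e : decode (α := α) n with - | a <;> simp [encodek]

theorem pair {f : α → β} {g : α → γ} (hf : ComputableIn O f) (hg : ComputableIn O g) :
    ComputableIn O fun a => (f a, g a) :=
  (Nat.RecursiveIn.pair hf hg).of_eq fun n => by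
    rcases e : decode (α := α) n with - | a <;> simp [Seq.seq]

theorem comp_primrec {f : β → σ} {g : α → β} (hf : ComputableIn O f) (hg : Primrec g) :
    ComputableIn O fun a => f (g a) :=
  hf.comp hg.computableIn

theorem _root_.Primrec.comp_computableIn {f : β → σ} {g : α → β} (hf : Primrec f)
    (hg : ComputableIn O g) : ComputableIn O fun a => f (g a) :=
  hf.computableIn.comp hg

theorem _root_.Primrec₂.comp_computableIn {f : β → γ → σ} {g : α → β} {h : α → γ}
    (hf : Primrec₂ f) (hg : ComputableIn O g) (hh : ComputableIn O h) :
    ComputableIn O fun a => f (g a) (h a) :=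
  Primrec.comp_computableIn (f := fun p : β × γ => f p.1 p.2) hf (hg.pair hh)

theorem cond {c : α → Bool} {f g : α → σ} (hc : ComputableIn O c) (hf : ComputableIn O f)
    (hg : ComputableIn O g) : ComputableIn O fun a => bif c a then f a else g a :=
  Primrec.comp_computableIn (f := fun p : Bool × σ × σ => bif p.1 then p.2.1 else p.2.2)
    (Primrec.cond .fst (.comp .fst .snd) (.comp .snd .snd)) (hc.pair (hf.pair hg))

theorem encode_iff {f : α → σ} : ComputableIn O (fun a => encode (f a)) ↔ ComputableIn O f := by
  simp [ComputableIn, RecursiveIn]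

theorem nat_rec {f : α → ℕ} {g : α → σ} {h : α → ℕ × σ → σ} (hf : ComputableIn O f)
    (hg : ComputableIn O g) (hh : ComputableIn₂ O h) :
    ComputableIn O fun a => ((f a).rec (g a) fun y IH => h a (y, IH) : σ) :=
  (Nat.RecursiveIn.comp (Nat.RecursiveIn.prec hg hh)
    (Nat.RecursiveIn.pair (Nat.RecursiveIn.of_eq (Primrec.id (α := ℕ)).computableIn
      (g := fun n => Part.some n) (by simp)) hf)).of_eq fun n => by
    rcases e : decode (α := α) n with - | a
    · simp [Seq.seq]
    · simp only [Part.coe_some, Part.bind_some, Part.map_some, Seq.seq, Part.map_eq_map,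
        Part.bind_eq_bind, Nat.unpair_pair, e]
      induction f a with
      | zero => simp [e]
      | succ m ih => simp_all

theorem find {p : α → ℕ → Bool} (hp : ComputableIn₂ O p) (h : ∀ a, ∃ n, p a n = true) :
    ComputableIn O fun a => Nat.find (h a) := by
  -- Unbounded search looks for a zero, so success is coded by 0.
  have h01 : ComputableIn O fun q : α × ℕ => bif p q.1 q.2 then 0 else 1 :=
    cond hp (.const 0) (.const 1)
  refine (Nat.RecursiveIn.rfind h01).of_eq fun n => ?_
  rcases e : decode (α := α) n with - | a
  · simpa [e] using Nat.rfind_zero_none _ rfl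
  · simp only [Part.coe_some, Part.bind_some, Part.map_some]
    refine Part.eq_some_iff.2 (Nat.mem_rfind.2 ⟨?_, fun {m} hm => ?_⟩)
    · have := Nat.find_spec (h a)
      simp [this, e]
    · have := Nat.find_min (h a) hm
      simp [this, e]

/-- A function is computable in `O` if its values are found by an unbounded search. -/
theorem of_search [Inhabited σ] {f : α → σ} {p : α → ℕ → Option σ} (hp : ComputableIn₂ O p)
    (hex : ∀ a, ∃ n, (p a n).isSome = true) (hval : ∀ a n b, p a n = some b → b = f a) :
    ComputableIn O f := by
  have h1 := find (O := O) (p := fun a n => (p a n).isSome)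
    (Primrec.option_isSome.comp_computableIn hp) hex
  refine (Primrec.option_getD_default.comp_computableIn
    (hp.comp (.pair .id h1))).of_eq fun a => ?_
  obtain ⟨b, hb⟩ := Option.isSome_iff_exists.1 (Nat.find_spec (hex a))
  simp only [id, hb, Option.getD_some]
  exact hval a _ b hb

end ComputableIn

open Encodable Denumerable

/-! ### Primitive recursive arithmetic on integers and cells. -/

section IntPrimrec

theorem Int.encode_natCast (n : ℕ) : encode (n : ℤ) = 2 * n := by
  change Equiv.natSumNatEquivNat (Sum.inl n) = _
  simp

theorem Int.encode_negSucc (n : ℕ) : encode (Int.negSucc n) = 2 * n + 1 := by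
  change Equiv.natSumNatEquivNat (Sum.inr n) = _
  simp

theorem Primrec.int_toNat : Primrec Int.toNat := by
  have h : Primrec fun z : ℤ => if encode z % 2 = 0 then encode z / 2 else 0 :=
    .ite (Primrec.eq.comp (nat_mod.comp .encode (.const 2)) (.const 0))
      (nat_div.comp .encode (.const 2)) (.const 0)
  refine h.of_eq fun z => ?_
  rcases z with n | n
  · simp [Int.encode_natCast]
  · simp [Int.encode_negSucc]

theorem Primrec.int_neg : Primrec (Neg.neg : ℤ → ℤ) := by
  -- For `n > 0` the codes of `n` and `-n` are `2n` and `2n - 1`; truncated subtraction takes care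
  -- of `0`.
  have h : Primrec fun z : ℤ => if encode z % 2 = 0 then encode z - 1 else encode z + 1 :=
    .ite (Primrec.eq.comp (nat_mod.comp .encode (.const 2)) (.const 0))
      (nat_sub.comp .encode (.const 1)) (Primrec.succ.comp .encode)
  refine encode_iff.1 (h.of_eq fun z => ?_)
  rcases z with (_ | n) | n
  · rfl
  · have : -Int.ofNat (n + 1) = Int.negSucc n := rfl
    rw [this, Int.encode_negSucc]
    simp only [Int.ofNat_eq_natCast, Int.encode_natCast]
    simp
    omega
  · have : -Int.negSucc n = ((n + 1 : ℕ) : ℤ) := rfl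
    rw [this, Int.encode_negSucc, Int.encode_natCast]
    simp
    omega

theorem Primrec.int_natCast : Primrec (Nat.cast : ℕ → ℤ) :=
  encode_iff.1 (nat_double.of_eq fun n => (Int.encode_natCast n).symm)

theorem Primrec.int_subNatNat : Primrec₂ fun a b : ℕ => (a : ℤ) - b := by
  have h : Primrec₂ fun a b : ℕ => if b ≤ a then ((a - b : ℕ) : ℤ) else -((b - a : ℕ) : ℤ) :=
    Primrec.ite (nat_le.comp .snd .fst) (int_natCast.comp (nat_sub.comp .fst .snd))
      (int_neg.comp (int_natCast.comp (nat_sub.comp .snd .fst)))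
  refine h.of_eq fun a b => ?_
  split_ifs <;> omega

theorem Primrec.int_add : Primrec₂ ((· + ·) : ℤ → ℤ → ℤ) := by
  have hp : Primrec fun p : ℤ × ℤ => p.1.toNat + p.2.toNat :=
    nat_add.comp (int_toNat.comp .fst) (int_toNat.comp .snd)
  have hn : Primrec fun p : ℤ × ℤ => (-p.1).toNat + (-p.2).toNat :=
    nat_add.comp (int_toNat.comp (int_neg.comp .fst)) (int_toNat.comp (int_neg.comp .snd))
  refine (int_subNatNat.comp hp hn).of_eq fun p => ?_
  push_cast
  omega

theorem Primrec.int_emod_toNat (N : ℕ) (hN : 0 < N) : Primrec fun z : ℤ => (z % N).toNat := by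
  -- Modulo `N` the negative part may be multiplied by `N - 1` instead of `-1`, which keeps
  -- everything in `ℕ`.
  have h : Primrec fun z : ℤ => (z.toNat + (N - 1) * (-z).toNat) % N :=
    nat_mod.comp (nat_add.comp int_toNat (nat_mul.comp (.const _) (int_toNat.comp int_neg)))
      (.const N)
  refine h.of_eq fun z => ?_
  zify
  rw [Int.toNat_of_nonneg (Int.emod_nonneg _ (by omega)), Nat.cast_sub (by omega)]
  refine Int.emod_emod_of_dvd z (dvd_refl (N : ℤ)) ▸ ?_
  rw [Int.emod_emod_of_dvd z (dvd_refl (N : ℤ))]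
  refine Int.ModEq.symm ((Int.modEq_iff_dvd).2 ⟨((-z).toNat : ℤ), ?_⟩)
  have : (z.toNat : ℤ) = z + (-z).toNat := by omega
  rw [this]
  push_cast
  ring

theorem Primrec.prodInt_add : Primrec₂ ((· + ·) : ℤ × ℤ → ℤ × ℤ → ℤ × ℤ) :=
  (Primrec.pair (int_add.comp (Primrec.fst.comp .fst) (Primrec.fst.comp .snd))
    (int_add.comp (Primrec.snd.comp .fst) (Primrec.snd.comp .snd))).of_eq fun _ => rfl

end IntPrimrec

/-- A doubly periodic configuration on a finite alphabet is computable. -/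
theorem computable_of_periods {A : Type*} [Primcodable A] {x : ℤ × ℤ → A} {M N : ℕ} (hM : 0 < M)
    (hN : 0 < N) (h₁ : ∀ p, x (p + ((M : ℤ), 0)) = x p) (h₂ : ∀ p, x (p + (0, (N : ℤ))) = x p) :
    Computable x := by
  have k₁ : ∀ (a : ℤ) i j, x (i + a * M, j) = x (i, j) := by
    intro a i j
    have hp : Function.Periodic (fun i => x (i, j)) (M : ℤ) := fun i => by
      simpa using h₁ (i, j)
    simpa using hp.int_mul a i
  have k₂ : ∀ (a : ℤ) i j, x (i, j + a * N) = x (i, j) := by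
    intro a i j
    have hp : Function.Periodic (fun j => x (i, j)) (N : ℤ) := fun j => by
      simpa using h₂ (i, j)
    simpa using hp.int_mul a j
  let f : Fin M × Fin N → A := fun q => x ((q.1 : ℕ), (q.2 : ℕ))
  have hf : Primrec f := .dom_finite f
  have hg : Primrec fun p : ℤ × ℤ =>
      ((⟨(p.1 % M).toNat, by have := Int.emod_lt_of_pos p.1 (Int.natCast_pos.2 hM); omega⟩,
        ⟨(p.2 % N).toNat, by have := Int.emod_lt_of_pos p.2 (Int.natCast_pos.2 hN); omega⟩) :
          Fin M × Fin N) :=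
    .pair (Primrec.fin_val_iff.1 ((Primrec.int_emod_toNat M hM).comp .fst))
      (Primrec.fin_val_iff.1 ((Primrec.int_emod_toNat N hN).comp .snd))
  refine ((hf.comp hg).of_eq fun p => ?_).to_comp
  have e₁ : ((p.1 % M).toNat : ℤ) = p.1 % M :=
    Int.toNat_of_nonneg (Int.emod_nonneg _ (by omega))
  have e₂ : ((p.2 % N).toNat : ℤ) = p.2 % N :=
    Int.toNat_of_nonneg (Int.emod_nonneg _ (by omega))
  simp only [f, e₁, e₂]
  rw [← k₁ (p.1 / M), ← k₂ (p.2 / N), Int.emod_add_ediv_mul, Int.emod_add_ediv_mul]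

/-! ### Configurations as sequences, their prefixes, and occurrences of patterns. -/

section Words

variable {A : Type*}

/-- Addition of the cells of `ℤ × ℤ`, numbered by their codes. -/
def cellAdd (v i : ℕ) : ℕ :=
  encode (ofNat (ℤ × ℤ) v + ofNat (ℤ × ℤ) i)

theorem ofNat_cellAdd (v i : ℕ) :
    ofNat (ℤ × ℤ) (cellAdd v i) = ofNat (ℤ × ℤ) v + ofNat (ℤ × ℤ) i :=
  ofNat_encode _

theorem cellAdd_assoc (u v i : ℕ) : cellAdd u (cellAdd v i) = cellAdd (cellAdd u v) i := by
  rw [cellAdd, ofNat_cellAdd, ← add_assoc, ← ofNat_cellAdd]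
  rfl

theorem cellAdd_zero_cell (i : ℕ) : cellAdd (encode (0 : ℤ × ℤ)) i = i := by
  rw [cellAdd, ofNat_encode, zero_add, encode_ofNat]

theorem Primrec.cellAdd : Primrec₂ cellAdd :=
  Primrec.encode.comp (Primrec.prodInt_add.comp ((Primrec.ofNat _).comp .fst)
    ((Primrec.ofNat _).comp .snd))

/-- The translate by the cell `v` of a configuration listed along the codes of the cells. -/
def shiftSeq (v : ℕ) (y : ℕ → A) : ℕ → A :=
  fun i => y (cellAdd v i)

theorem shiftSeq_shiftSeq (u v : ℕ) (y : ℕ → A) :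
    shiftSeq v (shiftSeq u y) = shiftSeq (cellAdd u v) y :=
  funext fun i => congrArg y (cellAdd_assoc u v i)

theorem shiftSeq_zero_cell (y : ℕ → A) : shiftSeq (encode (0 : ℤ × ℤ)) y = y :=
  funext fun i => congrArg y (cellAdd_zero_cell i)

/-- The prefix of length `m` of a sequence. -/
def initial (y : ℕ → A) (m : ℕ) : List A :=
  (List.range m).map y

@[simp] theorem length_initial (y : ℕ → A) (m : ℕ) : (initial y m).length = m := by
  simp [initial]

theorem getElem?_initial {y : ℕ → A} {m i : ℕ} (h : i < m) : (initial y m)[i]? = some (y i) := by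
  simp [initial, h]

theorem getElem?_initial_eq_some {y : ℕ → A} {m i : ℕ} {a : A} :
    (initial y m)[i]? = some a ↔ i < m ∧ y i = a := by
  rcases lt_or_ge i m with h | h
  · rw [getElem?_initial h, Option.some_inj, and_iff_right h]
  · simp [initial, h.not_gt]

theorem initial_succ (y : ℕ → A) (m : ℕ) : initial y (m + 1) = initial y m ++ [y m] := by
  simp [initial, List.range_succ]

theorem initial_prefix (y : ℕ → A) {m n : ℕ} (h : m ≤ n) : initial y m <+: initial y n := by
  induction n, h using Nat.le_induction with
  | base => exact List.prefix_rfl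
  | succ n _ ih => exact ih.trans (initial_succ y n ▸ List.prefix_append _ _)

theorem eq_initial_iff {y : ℕ → A} {u : List A} :
    initial y u.length = u ↔ ∀ i < u.length, u[i]? = some (y i) := by
  constructor
  · intro h i hi
    conv_lhs => rw [← h]
    exact getElem?_initial hi
  · intro h
    refine List.ext_getElem? fun i => ?_
    rcases lt_or_ge i u.length with hi | hi
    · rw [h i hi, getElem?_initial hi]
    · rw [List.getElem?_eq_none hi, List.getElem?_eq_none (by simpa using hi)]

theorem initial_eq_initial_iff {y z : ℕ → A} {m : ℕ} :
    initial y m = initial z m ↔ ∀ i < m, y i = z i := by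
  simp [initial]

/-- Compactness of the space of sequences, in terms of prefixes. -/
theorem exists_forall_initial [Finite A] {P : List A → Prop}
    (hP : ∀ w w', w <+: w' → P w' → P w) (h : ∀ m, ∃ w : List A, w.length = m ∧ P w) [Inhabited A] :
    ∃ y : ℕ → A, ∀ m, P (initial y m) := by
  let _ : TopologicalSpace A := ⊥
  have : DiscreteTopology A := ⟨rfl⟩
  have hcl : ∀ m, IsClosed {y : ℕ → A | P (initial y m)} := fun m => by
    have hc : Continuous fun (y : ℕ → A) (i : Fin m) => y i := by fun_prop
    have e : ∀ y : ℕ → A, initial y m = List.ofFn fun i : Fin m => y i := fun y =>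
      List.ext_getElem (by simp) (by simp [initial])
    simp only [e]
    exact (isClosed_discrete {f : Fin m → A | P (List.ofFn f)}).preimage hc
  have hne : ∀ m, {y : ℕ → A | P (initial y m)}.Nonempty := fun m => by
    obtain ⟨w, rfl, hw⟩ := h m
    refine ⟨fun i => w.getD i default, ?_⟩
    rw [Set.mem_ofPred_eq, eq_initial_iff.2]
    · exact hw
    · intro i hi
      simp [hi]
  obtain ⟨y, hy⟩ := IsCompact.nonempty_iInter_of_sequence_nonempty_isCompact_isClosed
    (fun m => {y : ℕ → A | P (initial y m)})
    (fun m y hy => hP _ _ (initial_prefix y m.le_succ) hy) hne (hcl 0).isCompact hcl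
  exact ⟨y, fun m => Set.mem_iInter.1 hy m⟩

/-- The word `u`, read as a pattern, occurs in the word `w` at the cell `v`. -/
def OccursIn (u w : List A) (v : ℕ) : Prop :=
  ∀ i < u.length, w[cellAdd v i]? = u[i]?

theorem OccursIn.initial_shiftSeq {u : List A} {y : ℕ → A} {m v : ℕ}
    (h : OccursIn u (initial y m) v) : initial (shiftSeq v y) u.length = u :=
  eq_initial_iff.2 fun i hi => by
    have h1 := h i hi
    rw [List.getElem?_eq_getElem hi] at h1 ⊢
    rw [(getElem?_initial_eq_some.1 h1).2.symm, shiftSeq]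

theorem exists_bound (v n : ℕ) : ∃ m, v < m ∧ ∀ i < n, cellAdd v i < m :=
  ⟨v + 1 + ∑ i ∈ Finset.range n, (cellAdd v i + 1), by omega, fun i hi => by
    have := Finset.single_le_sum (f := fun i => cellAdd v i + 1) (fun _ _ => Nat.zero_le _)
      (Finset.mem_range.2 hi)
    omega⟩

theorem occursIn_initial_of_bound {u : List A} {y : ℕ → A} {m v : ℕ}
    (h : initial (shiftSeq v y) u.length = u) (hm : ∀ i < u.length, cellAdd v i < m) :
    OccursIn u (initial y m) v := fun i hi => by
  rw [getElem?_initial (hm i hi), eq_initial_iff.1 h i hi, shiftSeq]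

theorem OccursIn.mono {u w w' : List A} {v : ℕ} (h : OccursIn u w v) (hw : w <+: w') :
    OccursIn u w' v := fun i hi => by
  have h1 := h i hi
  rw [List.getElem?_eq_getElem hi] at h1 ⊢
  obtain ⟨h2, h3⟩ := List.getElem?_eq_some_iff.1 h1
  rw [← h3, hw.getElem h2, List.getElem?_eq_getElem]

end Words

/-! ### The minimal subsystem and its language. -/

section MinimalSystem

variable {A : Type*}

/-- The word `w` is ruled out by the tree `B` or by the occurrence of some pattern of `S`. -/
def Bad (B : List A → Prop) (S : List (List A)) (w : List A) : Prop :=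
  B w ∨ ∃ v < w.length, ∃ u ∈ S, OccursIn u w v

/-- No point of the class of `B` avoids the patterns of `S`, as is seen at some finite level. -/
def Empties (B : List A → Prop) (S : List (List A)) : Prop :=
  ∃ m, ∀ w : List A, w.length = m → Bad B S w

/-- The class of `B` is closed under translation, and `B` is closed under extension. -/
structure ShiftTree (B : List A → Prop) : Prop where
  mono : ∀ w w', w <+: w' → B w → B w'
  shift : ∀ (y : ℕ → A) v, (∀ m, ¬ B (initial y m)) → ∀ m, ¬ B (initial (shiftSeq v y) m)
  nonempty : ∃ y : ℕ → A, ∀ m, ¬ B (initial y m)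

open Classical in
/-- Forbid one word after the other whenever that leaves some point. -/
noncomputable def forbiddenWords [Encodable A] (B : List A → Prop) : ℕ → List (List A)
  | 0 => []
  | n + 1 =>
    if Empties B (((decode n : Option (List A)).getD []) :: forbiddenWords B n) then
      forbiddenWords B n
    else ((decode n : Option (List A)).getD []) :: forbiddenWords B n

/-- The minimal subsystem cut out by `forbiddenWords`. -/
def InMinimal [Encodable A] (B : List A → Prop) (y : ℕ → A) : Prop :=
  ∀ n m, ¬ Bad B (forbiddenWords B n) (initial y m)

/-- The word `u` could not be forbidden: it occurs in the points of the minimal subsystem. -/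
def InLanguage [Encodable A] (B : List A → Prop) (u : List A) : Prop :=
  Empties B (u :: forbiddenWords B (encode u))

variable {B : List A → Prop}

theorem Bad.mono (hB : ShiftTree B) {S S' : List (List A)} {w w' : List A} (h : Bad B S w)
    (hS : S ⊆ S') (hw : w <+: w') : Bad B S' w' := by
  rcases h with h | ⟨v, hv, u, hu, h⟩
  · exact .inl (hB.mono _ _ hw h)
  · exact .inr ⟨v, hv.trans_le hw.length_le, u, hS hu, h.mono hw⟩

theorem not_empties_of_exists {S : List (List A)} {y : ℕ → A}
    (h : ∀ m, ¬ Bad B S (initial y m)) : ¬ Empties B S := fun ⟨m, hm⟩ =>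
  h m (hm _ (length_initial y m))

/-- An occurrence at any cell is visible in a long enough prefix, so the bound on `v` in `Bad` loses
nothing in the limit. -/
theorem not_bad_iff {S : List (List A)} {y : ℕ → A} : (∀ m, ¬ Bad B S (initial y m)) ↔
    (∀ m, ¬ B (initial y m)) ∧ ∀ u ∈ S, ∀ v, initial (shiftSeq v y) u.length ≠ u := by
  constructor
  · refine fun h => ⟨fun m hm => h m (.inl hm), fun u hu v hv => ?_⟩
    obtain ⟨m, hvm, hm⟩ := exists_bound v u.length
    exact h m (.inr ⟨v, by simpa using hvm, u, hu, occursIn_initial_of_bound hv hm⟩)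
  · rintro ⟨h1, h2⟩ m (hm | ⟨v, -, u, hu, h⟩)
    · exact h1 m hm
    · exact h2 u hu v h.initial_shiftSeq

theorem not_bad_shiftSeq (hB : ShiftTree B) {S : List (List A)} {y : ℕ → A}
    (h : ∀ m, ¬ Bad B S (initial y m)) (v : ℕ) : ∀ m, ¬ Bad B S (initial (shiftSeq v y) m) := by
  rw [not_bad_iff] at h ⊢
  exact ⟨hB.shift y v h.1, fun u hu v' => by rw [shiftSeq_shiftSeq]; exact h.2 u hu _⟩

variable [Encodable A]

theorem InMinimal.shiftSeq (hB : ShiftTree B) {y : ℕ → A} (h : InMinimal B y) (v : ℕ) :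
    InMinimal B (shiftSeq v y) :=
  fun n => not_bad_shiftSeq hB (h n) v

theorem forbiddenWords_subset {m n : ℕ} (h : m ≤ n) :
    forbiddenWords B m ⊆ forbiddenWords B n := by
  induction n, h using Nat.le_induction with
  | base => exact List.Subset.refl _
  | succ n _ ih =>
    rw [forbiddenWords]
    split_ifs
    · exact ih
    · exact List.subset_cons_of_subset _ ih

/-- A number that decodes to no word proposes `[]`; this occurs everywhere, so it is never added. -/
theorem not_empties_forbiddenWords (hB : ShiftTree B) (n : ℕ) :
    ¬ Empties B (forbiddenWords B n) := by
  induction n with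
  | zero =>
    obtain ⟨y, hy⟩ := hB.nonempty
    exact not_empties_of_exists (not_bad_iff.2 ⟨hy, by simp [forbiddenWords]⟩)
  | succ n ih =>
    rw [forbiddenWords]
    split_ifs with h
    exacts [ih, h]

/-- The length of a word also serves as the stage of the construction, so that a single application
of compactness handles all stages. -/
theorem exists_inMinimal [Finite A] [Inhabited A] (hB : ShiftTree B) :
    ∃ y : ℕ → A, InMinimal B y := by
  obtain ⟨y, hy⟩ := exists_forall_initial (A := A)
    (P := fun w => ¬ Bad B (forbiddenWords B w.length) w)
    (fun w w' hw h1 h2 => h1 (h2.mono hB (forbiddenWords_subset hw.length_le) hw)) fun m => by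
      have := not_empties_forbiddenWords hB m
      simp only [Empties, not_exists, not_forall] at this
      obtain ⟨w, rfl, h⟩ := this m
      exact ⟨w, rfl, h⟩
  refine ⟨y, fun n m h => hy (max n m) (h.mono hB ?_ (initial_prefix y (le_max_right n m)))⟩
  rw [length_initial]
  exact forbiddenWords_subset (le_max_left n m)

/-- The words of the language occur in all points, with bounded gaps. -/
theorem InLanguage.exists_bound {u : List A} (hu : InLanguage B u) :
    ∃ m, ∀ y : ℕ → A, InMinimal B y → ∃ v < m, initial (_root_.shiftSeq v y) u.length = u := by
  obtain ⟨m, hm⟩ := hu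
  refine ⟨m, fun y hy => ?_⟩
  -- A prefix of length `m` is bad once `u` is added, but not before; hence `u` itself occurs at a
  -- cell below `m`.
  have h1 := hy (encode u) m
  rcases hm _ (length_initial y m) with h2 | ⟨v, hv, u', hu', h2⟩
  · exact absurd (.inl h2) h1
  · rcases List.mem_cons.1 hu' with rfl | hu'
    · exact ⟨v, by simpa using hv, h2.initial_shiftSeq⟩
    · exact absurd (.inr ⟨v, hv, u', hu', h2⟩) h1

/-- Were the prefix outside the language, it would have been forbidden at its own turn, yet it
occurs at the zero cell. -/
theorem InMinimal.inLanguage {y : ℕ → A} (hy : InMinimal B y) (m : ℕ) :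
    InLanguage B (initial y m) := by
  by_contra h
  have h1 : initial y m ∈ forbiddenWords B (encode (initial y m) + 1) := by
    rw [InLanguage] at h
    rw [forbiddenWords]
    simp [h]
  have h2 := (not_bad_iff.1 (hy (encode (initial y m) + 1))).2 _ h1 (encode (0 : ℤ × ℤ))
  rw [shiftSeq_zero_cell, length_initial] at h2
  exact h2 rfl

theorem InLanguage.exists_inMinimal [Finite A] [Inhabited A] (hB : ShiftTree B) {u : List A}
    (hu : InLanguage B u) : ∃ y : ℕ → A, InMinimal B y ∧ initial y u.length = u := by
  obtain ⟨y, hy⟩ := _root_.exists_inMinimal hB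
  obtain ⟨m, hm⟩ := hu.exists_bound
  obtain ⟨v, -, hv⟩ := hm y hy
  exact ⟨_, hy.shiftSeq hB v, hv⟩

theorem inLanguage_nil [Finite A] [Inhabited A] (hB : ShiftTree B) :
    InLanguage B ([] : List A) := by
  obtain ⟨y, hy⟩ := exists_inMinimal hB
  exact hy.inLanguage 0

theorem InLanguage.exists_append [Finite A] [Inhabited A] (hB : ShiftTree B) {u : List A}
    (hu : InLanguage B u) : ∃ a, InLanguage B (u ++ [a]) := by
  obtain ⟨y, hy, h⟩ := hu.exists_inMinimal hB
  have := hy.inLanguage (u.length + 1)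
  rw [initial_succ, h] at this
  exact ⟨_, this⟩

theorem inMinimal_of_inLanguage [Finite A] [Inhabited A] (hB : ShiftTree B) {y : ℕ → A}
    (h : ∀ m, InLanguage B (initial y m)) : InMinimal B y := fun n m => by
  obtain ⟨z, hz, h1⟩ := (h m).exists_inMinimal hB
  rw [length_initial] at h1
  exact h1 ▸ hz n m

/-- If all occurrences in `y` of some prefix of `y` are periods of `y`, then `y` is computable. -/
theorem InMinimal.computable_of_periodic {A : Type*} [Primcodable A] {B : List A → Prop}
    (hB : ShiftTree B) {y : ℕ → A} (hy : InMinimal B y) (k : ℕ)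
    (h : ∀ v, initial (_root_.shiftSeq v y) k = initial y k → _root_.shiftSeq v y = y) :
    Computable fun p : ℤ × ℤ => y (encode p) := by
  set x : ℤ × ℤ → A := fun p => y (encode p) with hx
  obtain ⟨m, hm⟩ := (hy.inLanguage k).exists_bound
  rw [length_initial] at hm
  have hs : ∀ v : ℕ, _root_.shiftSeq v y = y → ∀ p, x (ofNat (ℤ × ℤ) v + p) = x p := by
    intro v H p
    have := congrFun H (encode p)
    rwa [_root_.shiftSeq, cellAdd, ofNat_encode] at this
  -- From any cell `q`, a return of the prefix lies within one of finitely many displacements, and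
  -- by assumption it gives a period.
  have key : ∀ q : ℤ × ℤ, ∃ v < m, ∀ p, x (q + ofNat (ℤ × ℤ) v + p) = x p := by
    intro q
    obtain ⟨v, hv, h1⟩ := hm _ (hy.shiftSeq hB (encode q))
    rw [shiftSeq_shiftSeq] at h1
    refine ⟨v, hv, ?_⟩
    have := hs _ (h _ h1)
    rwa [ofNat_cellAdd, ofNat_encode] at this
  choose f hf hfp using key
  -- By pigeonhole two terms of `g` share a displacement, which cancels in the difference of the two
  -- periods. Apply this along each axis.
  have period : ∀ g : ℕ → ℤ × ℤ, ∃ i j, i < j ∧ ∀ p, x (p + (g j - g i)) = x p := by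
    intro g
    obtain ⟨i, j, hij, he⟩ := Finite.exists_ne_map_eq_of_infinite
      fun n => (⟨f (g n), hf (g n)⟩ : Fin m)
    have he : f (g i) = f (g j) := by simpa using he
    have H : ∀ i j, f (g i) = f (g j) → ∀ p, x (p + (g j - g i)) = x p := fun i j he p => by
      rw [← hfp (g i) (p + (g j - g i)), ← hfp (g j) p, he]
      congr 1
      abel
    rcases lt_or_gt_of_ne hij with hlt | hlt
    · exact ⟨i, j, hlt, H i j he⟩
    · exact ⟨j, i, hlt, H j i he.symm⟩
  obtain ⟨i, j, hij, h1⟩ := period fun n => ((n : ℤ), 0)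
  obtain ⟨i', j', hij', h2⟩ := period fun n => (0, (n : ℤ))
  refine computable_of_periods (M := j - i) (N := j' - i') (by omega) (by omega)
    (fun p => ?_) fun p => ?_
  · simpa [Nat.cast_sub hij.le] using h1 p
  · simpa [Nat.cast_sub hij'.le] using h2 p

end MinimalSystem

/-! ### Coding a binary sequence by greedy choices. -/

section Coding

variable {A : Type*}

/-- In `w`, the translate by `v` agrees with the untranslated word before the cell `z ≥ k`, and
differs from it at `z`. -/
def Branches (k : ℕ) (w : List A) (v z : ℕ) : Prop :=
  v < w.length ∧ z < w.length ∧ k ≤ z ∧ (∀ i < z, w[cellAdd v i]? = w[i]?) ∧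
    cellAdd v z < w.length ∧ w[cellAdd v z]? ≠ w[z]?

/-- Some pair of cells branches in `w`. -/
def HasBranch (k : ℕ) (w : List A) : Prop :=
  ∃ z < w.length, ∃ v < w.length, Branches k w v z

open Classical in
/-- The number of bits coded by the prefixes of `w` of length up to `n`, and the length at which
the coding of the current bit started. -/
noncomputable def codingState (w : List A) : ℕ → ℕ × ℕ
  | 0 => (0, 0)
  | n + 1 =>
    if HasBranch (codingState w n).2 (w.take (n + 1)) then ((codingState w n).1 + 1, n + 1)
    else codingState w n

/-- The state depends on the prefix alone, so a decoder that sees only the point can reconstruct it.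
-/
theorem codingState_congr {w w' : List A} {n : ℕ} (h : w.take n = w'.take n) :
    codingState w n = codingState w' n := by
  induction n with
  | zero => rfl
  | succ n ih =>
    have h' : w.take n = w'.take n := by
      simpa [List.take_take] using congrArg (List.take n) h
    rw [codingState, codingState, ih h', h]

theorem take_initial (y : ℕ → A) {m n : ℕ} (h : n ≤ m) : (initial y m).take n = initial y n := by
  simp [initial, ← List.map_take, List.take_range, h]

theorem codingState_initial_succ (y : ℕ → A) (m : ℕ) [Decidable
    (HasBranch (codingState (initial y m) m).2 (initial y (m + 1)))] :
    codingState (initial y (m + 1)) (m + 1) =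
      if HasBranch (codingState (initial y m) m).2 (initial y (m + 1)) then
        ((codingState (initial y m) m).1 + 1, m + 1)
      else codingState (initial y m) m := by
  have h : codingState (initial y (m + 1)) m = codingState (initial y m) m :=
    codingState_congr (by rw [take_initial y m.le_succ, take_initial y le_rfl])
  rw [codingState, h, take_initial y le_rfl]
  congr

/-- The letter at `z` comes before the letter at the translate of `z` by `v`. -/
def letterBit [DecidableEq A] [Inhabited A] (l : List A) (w : List A) (v z : ℕ) : Bool :=
  decide (l.idxOf (w[z]?.getD default) < l.idxOf (w[cellAdd v z]?.getD default))

open Classical in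
/-- The first letter after `w` in the language, in the order of `l` or in the opposite order. -/
noncomputable def greedyLetter [Encodable A] [Inhabited A] (B : List A → Prop) (l : List A)
    (b : Bool) (w : List A) : A :=
  ((bif b then l else l.reverse).find? fun a => decide (InLanguage B (w ++ [a]))).getD default

/-- The words of the point that codes `s`. -/
noncomputable def codingWord [Encodable A] [Inhabited A] (B : List A → Prop) (l : List A)
    (s : ℕ → Bool) : ℕ → List A
  | 0 => []
  | n + 1 => codingWord B l s n ++
      [greedyLetter B l (s (codingState (codingWord B l s n) n).1) (codingWord B l s n)]

/-- The point that codes `s`. -/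
noncomputable def codingSeq [Encodable A] [Inhabited A] (B : List A → Prop) (l : List A)
    (s : ℕ → Bool) (n : ℕ) : A :=
  greedyLetter B l (s (codingState (codingWord B l s n) n).1) (codingWord B l s n)

theorem List.idxOf_lt_of_find?_eq_some [DecidableEq A] {l : List A} {p : A → Bool} {a a' : A}
    (h : l.find? p = some a) (ha' : p a' = true) (hne : a' ≠ a) : l.idxOf a < l.idxOf a' := by
  obtain ⟨_, as, bs, rfl, has⟩ := List.find?_eq_some_iff_append.1 h
  have h1 : a ∉ as := fun hm => by simp_all
  have h2 : a' ∉ as := fun hm => by simpa [ha'] using has a' hm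
  rw [List.idxOf_append_of_notMem h1, List.idxOf_append_of_notMem h2]
  simp [List.idxOf_cons_ne _ hne.symm]

/-- Without repetitions, the last place of a letter (seen by the reversed search) is also its first
(seen by `idxOf`). -/
theorem List.idxOf_lt_of_find?_reverse_eq_some [DecidableEq A] {l : List A} (hl : l.Nodup)
    {p : A → Bool} {a a' : A} (h : l.reverse.find? p = some a) (ha' : p a' = true) (hne : a' ≠ a)
    (hm : a' ∈ l) : l.idxOf a' < l.idxOf a := by
  obtain ⟨_, as, bs, he, has⟩ := List.find?_eq_some_iff_append.1 h
  obtain rfl : l = bs.reverse ++ a :: as.reverse := by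
    rw [← List.reverse_reverse (as := l), he]
    simp
  have h2 : a' ∉ as := fun hm => by simpa [ha'] using has a' hm
  have h3 : a' ∈ bs.reverse := by simpa [hne, h2] using hm
  have h4 : a ∉ bs.reverse := fun h5 => by
    rw [List.nodup_append] at hl
    exact hl.2.2 _ h5 _ List.mem_cons_self rfl
  rw [List.idxOf_append_of_mem h3, List.idxOf_append_of_notMem h4]
  have := List.idxOf_lt_length_iff.2 h3
  omega

variable [Encodable A] [Inhabited A] {B : List A → Prop} {l : List A} {s : ℕ → Bool}

theorem initial_codingSeq (n : ℕ) : initial (codingSeq B l s) n = codingWord B l s n := by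
  induction n with
  | zero => rfl
  | succ n ih => rw [initial_succ, ih, codingWord, codingSeq]

theorem codingSeq_eq (n : ℕ) : codingSeq B l s n =
    greedyLetter B l (s (codingState (initial (codingSeq B l s) n) n).1)
      (initial (codingSeq B l s) n) := by
  rw [initial_codingSeq, codingSeq]

open Classical in
theorem find?_eq_greedyLetter (hl : ∀ a, a ∈ l) {w : List A}
    (h : ∃ a, InLanguage B (w ++ [a])) (b : Bool) :
    (bif b then l else l.reverse).find? (fun a => decide (InLanguage B (w ++ [a]))) =
      some (greedyLetter B l b w) := by
  obtain ⟨a, ha⟩ := h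
  have : ((bif b then l else l.reverse).find?
      fun a => decide (InLanguage B (w ++ [a]))).isSome := by
    rw [List.find?_isSome]
    refine ⟨a, ?_, by simpa using ha⟩
    cases b <;> simp [hl]
  obtain ⟨c, hc⟩ := Option.isSome_iff_exists.1 this
  rw [greedyLetter, hc, Option.getD_some]

theorem greedyLetter_inLanguage (hl : ∀ a, a ∈ l) {w : List A}
    (h : ∃ a, InLanguage B (w ++ [a])) (b : Bool) :
    InLanguage B (w ++ [greedyLetter B l b w]) := by
  simpa using List.find?_some (find?_eq_greedyLetter hl h b)

theorem decide_idxOf_greedyLetter [DecidableEq A] (hl : ∀ a, a ∈ l) (hn : l.Nodup) {w : List A}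
    {a : A} (ha : InLanguage B (w ++ [a])) (b : Bool) (hne : a ≠ greedyLetter B l b w) :
    decide (l.idxOf (greedyLetter B l b w) < l.idxOf a) = b := by
  have h := find?_eq_greedyLetter hl ⟨a, ha⟩ b
  cases b with
  | true => simpa using List.idxOf_lt_of_find?_eq_some h (by simpa using ha) hne
  | false =>
    simpa using (List.idxOf_lt_of_find?_reverse_eq_some hn h (by simpa using ha) hne (hl a)).le

theorem inMinimal_codingSeq [Finite A] (hB : ShiftTree B) (hl : ∀ a, a ∈ l) :
    InMinimal B (codingSeq B l s) := by
  refine inMinimal_of_inLanguage hB fun m => ?_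
  induction m with
  | zero => exact inLanguage_nil hB
  | succ m ih =>
    rw [initial_succ, codingSeq_eq]
    exact greedyLetter_inLanguage hl (ih.exists_append hB) _

/-- While a bit is being coded, all letters are greedy for it. -/
theorem codingSeq_eq_of_codingState {m i : ℕ}
    (h : (codingState (initial (codingSeq B l s) m) m).2 ≤ i) (hi : i ≤ m) :
    codingSeq B l s i = greedyLetter B l (s (codingState (initial (codingSeq B l s) m) m).1)
      (initial (codingSeq B l s) i) := by
  classical
  induction m with
  | zero =>
    obtain rfl : i = 0 := by omega
    exact codingSeq_eq 0
  | succ m ih =>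
    rcases hi.eq_or_lt with rfl | hi
    · exact codingSeq_eq _
    · rw [codingState_initial_succ] at h ⊢
      split_ifs at h ⊢ with hb
      · simp only at h
        omega
      · exact ih h (by omega)

/-- Every branching pair of cells shows the bit that is being coded. -/
theorem letterBit_codingSeq [Finite A] [DecidableEq A] (hB : ShiftTree B) (hl : ∀ a, a ∈ l) (hn : l.Nodup)
    {m v z : ℕ} (h : Branches (codingState (initial (codingSeq B l s) m) m).2
      (initial (codingSeq B l s) (m + 1)) v z) :
    letterBit l (initial (codingSeq B l s) (m + 1)) v z =
      s (codingState (initial (codingSeq B l s) m) m).1 := by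
  set y := codingSeq B l s with hy
  obtain ⟨-, hz, hk, heq, hvz, hne⟩ := h
  rw [length_initial] at hz hvz
  rw [letterBit, getElem?_initial hz, getElem?_initial hvz, Option.getD_some, Option.getD_some]
  rw [getElem?_initial hz, getElem?_initial hvz, ne_eq, Option.some_inj] at hne
  have hyz := codingSeq_eq_of_codingState (B := B) (l := l) (s := s) hk (by omega)
  rw [← hy] at hyz
  -- The letters at `z` and at its translate follow the same prefix, so they compete in the same
  -- greedy choice.
  have hpre : initial (shiftSeq v y) z = initial y z := initial_eq_initial_iff.2 fun i hi => by
    have h1 := heq i hi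
    rw [getElem?_initial (hi.trans hz)] at h1
    exact (getElem?_initial_eq_some.1 h1).2
  -- The translate of `y` lies in the subsystem as well, so its letter was admissible too.
  have hL : InLanguage B (initial y z ++ [y (cellAdd v z)]) := by
    have h1 := ((inMinimal_codingSeq (s := s) hB hl).shiftSeq hB v).inLanguage (z + 1)
    rwa [← hy, initial_succ, hpre] at h1
  rw [hyz] at hne ⊢
  exact decide_idxOf_greedyLetter hl hn hL _ hne

end Coding

/-! ### Every bit is eventually coded. -/

section Progress

variable {A : Type*} [Primcodable A] {B : List A → Prop}

theorem exists_hasBranch (hB : ShiftTree B) {y : ℕ → A} (hy : InMinimal B y)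
    (hc : ¬ Computable fun p : ℤ × ℤ => y (encode p)) (k : ℕ) :
    ∃ m₀, ∀ m ≥ m₀, HasBranch k (initial y m) := by
  by_contra hcon
  refine hc (hy.computable_of_periodic hB k fun v hv => ?_)
  by_contra hne
  refine hcon ?_
  classical
  -- The return `v` of the prefix is not a period; the first disagreement gives the branching cell.
  have hex : ∃ z, shiftSeq v y z ≠ y z := by
    by_contra h
    push Not at h
    exact hne (funext h)
  set z := Nat.find hex
  have hz : shiftSeq v y z ≠ y z := Nat.find_spec hex
  have hzm : ∀ i < z, shiftSeq v y i = y i := fun i hi => not_not.1 (Nat.find_min hex hi)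
  have hk : k ≤ z := by
    by_contra h
    exact hz (initial_eq_initial_iff.1 hv z (by omega))
  obtain ⟨m₁, hv₁, hm₁⟩ := exists_bound v (z + 1)
  refine ⟨max m₁ (z + 1), fun m hm => ?_⟩
  have h1 : m₁ ≤ m := le_of_max_le_left hm
  have h2 : z + 1 ≤ m := le_of_max_le_right hm
  have hb : ∀ i < z + 1, cellAdd v i < m := fun i hi => (hm₁ i hi).trans_le h1
  refine ⟨z, by simpa using h2, v, by simpa using hv₁.trans_le h1, by simpa using hv₁.trans_le h1,
    by simpa using h2, hk, fun i hi => ?_, by simpa using hb z (by omega), ?_⟩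
  · rw [getElem?_initial (hb i (by omega)), getElem?_initial (by omega)]
    exact congrArg some (hzm i hi)
  · rw [getElem?_initial (hb z (by omega)), getElem?_initial (by omega), ne_eq, Option.some_inj]
    exact hz

theorem exists_codingState (hB : ShiftTree B) {y : ℕ → A} (hy : InMinimal B y)
    (hc : ¬ Computable fun p : ℤ × ℤ => y (encode p)) (j : ℕ) :
    ∃ m, (codingState (initial y m) m).1 = j ∧
      HasBranch (codingState (initial y m) m).2 (initial y (m + 1)) := by
  classical
  -- Without a further branch the state would be frozen from `m` on, but a branch above its fixed
  -- starting length must appear.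
  have step : ∀ m, ∃ m', (codingState (initial y m') m').1 = (codingState (initial y m) m).1 ∧
      HasBranch (codingState (initial y m') m').2 (initial y (m' + 1)) := by
    intro m
    by_contra hcon
    push Not at hcon
    have hst : ∀ m' ≥ m, codingState (initial y m') m' = codingState (initial y m) m := by
      intro m' hm'
      induction m', hm' using Nat.le_induction with
      | base => rfl
      | succ n _ ih => rw [codingState_initial_succ, if_neg (hcon n (by rw [ih])), ih]
    obtain ⟨m₀, hm₀⟩ := exists_hasBranch hB hy hc (codingState (initial y m) m).2
    have h1 := hst (max m m₀) (le_max_left _ _)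
    refine hcon (max m m₀) (by rw [h1]) ?_
    rw [h1]
    exact hm₀ _ ((le_max_right m m₀).trans (Nat.le_succ _))
  induction j with
  | zero =>
    obtain ⟨m, h1, h2⟩ := step 0
    exact ⟨m, h1, h2⟩
  | succ j ih =>
    obtain ⟨m, h1, h2⟩ := ih
    obtain ⟨m', h3, h4⟩ := step (m + 1)
    rw [codingState_initial_succ, if_pos h2, h1] at h3
    exact ⟨m', h3, h4⟩

end Progress

/-! ### Primitive recursive and semidecidable predicates on words. -/

section Primrec

variable {A : Type*} [Primcodable A] {α β : Type*} [Primcodable α] [Primcodable β]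

theorem PrimrecRel.exists_lt_comp {R : ℕ → α → Prop} (hR : PrimrecRel R) {f : α → ℕ}
    (hf : Primrec f) : PrimrecPred fun a => ∃ n < f a, R n a :=
  (hR.exists_mem_list.comp (Primrec.list_range.comp hf) .id).of_eq fun a => by simp

theorem PrimrecRel.forall_lt_comp {R : ℕ → α → Prop} (hR : PrimrecRel R) {f : α → ℕ}
    (hf : Primrec f) : PrimrecPred fun a => ∀ n < f a, R n a :=
  (hR.forall_mem_list.comp (Primrec.list_range.comp hf) .id).of_eq fun a => by simp

theorem PrimrecRel.exists_mem_comp {R : β → α → Prop} (hR : PrimrecRel R) {f : α → List β}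
    (hf : Primrec f) : PrimrecPred fun a => ∃ b ∈ f a, R b a :=
  hR.exists_mem_list.comp hf .id

theorem PrimrecRel.forall_mem_comp {R : β → α → Prop} (hR : PrimrecRel R) {f : α → List β}
    (hf : Primrec f) : PrimrecPred fun a => ∀ b ∈ f a, R b a :=
  hR.forall_mem_list.comp hf .id

theorem primrecPred_occursIn :
    PrimrecPred fun p : List A × List A × ℕ => OccursIn p.1 p.2.1 p.2.2 := by
  refine PrimrecRel.forall_lt_comp
    (R := fun i (p : List A × List A × ℕ) => p.2.1[cellAdd p.2.2 i]? = p.1[i]?) ?_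
    (Primrec.list_length.comp .fst)
  have hp : Primrec fun q : ℕ × List A × List A × ℕ => q.2 := .snd
  exact Primrec.eq.comp
    (Primrec.list_getElem?.comp (Primrec.fst.comp (Primrec.snd.comp hp))
      (Primrec.cellAdd.comp (Primrec.snd.comp (Primrec.snd.comp hp)) .fst))
    (Primrec.list_getElem?.comp (Primrec.fst.comp hp) .fst)

theorem primrecRel_bad {B : List A → Prop} (hB : PrimrecPred B) : PrimrecRel (Bad B) := by
  refine (hB.comp .snd).or (PrimrecRel.exists_lt_comp
    (R := fun v (p : List (List A) × List A) => ∃ u ∈ p.1, OccursIn u p.2 v) ?_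
    (Primrec.list_length.comp .snd))
  refine PrimrecRel.exists_mem_comp
    (R := fun u (q : ℕ × List (List A) × List A) => OccursIn u q.2.2 q.1) ?_
    (Primrec.fst.comp .snd)
  exact primrecPred_occursIn.comp (.pair .fst (.pair (Primrec.snd.comp (Primrec.snd.comp .snd))
    (Primrec.fst.comp .snd)))

theorem primrecPred_branches :
    PrimrecPred fun p : ℕ × List A × ℕ × ℕ => Branches p.1 p.2.1 p.2.2.1 p.2.2.2 := by
  have hk : Primrec fun p : ℕ × List A × ℕ × ℕ => p.1 := .fst
  have hw : Primrec fun p : ℕ × List A × ℕ × ℕ => p.2.1 := .comp .fst .snd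
  have hv : Primrec fun p : ℕ × List A × ℕ × ℕ => p.2.2.1 := .comp .fst (.comp .snd .snd)
  have hz : Primrec fun p : ℕ × List A × ℕ × ℕ => p.2.2.2 := .comp .snd (.comp .snd .snd)
  have hl := Primrec.list_length.comp hw
  have h4 : PrimrecPred fun p : ℕ × List A × ℕ × ℕ =>
      ∀ i < p.2.2.2, p.2.1[cellAdd p.2.2.1 i]? = p.2.1[i]? := by
    refine PrimrecRel.forall_lt_comp (R := fun i (p : ℕ × List A × ℕ × ℕ) =>
      p.2.1[cellAdd p.2.2.1 i]? = p.2.1[i]?) ?_ hz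
    exact Primrec.eq.comp
      (Primrec.list_getElem?.comp (hw.comp .snd) (Primrec.cellAdd.comp (hv.comp .snd) .fst))
      (Primrec.list_getElem?.comp (hw.comp .snd) .fst)
  exact (Primrec.nat_lt.comp hv hl).and <| (Primrec.nat_lt.comp hz hl).and <|
    (Primrec.nat_le.comp hk hz).and <| h4.and <|
    (Primrec.nat_lt.comp (Primrec.cellAdd.comp hv hz) hl).and
      (Primrec.eq.comp (Primrec.list_getElem?.comp hw (Primrec.cellAdd.comp hv hz))
        (Primrec.list_getElem?.comp hw hz)).not

theorem primrecRel_hasBranch : PrimrecRel (HasBranch (A := A)) := by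
  refine PrimrecRel.exists_lt_comp (R := fun z (p : ℕ × List A) =>
    ∃ v < p.2.length, Branches p.1 p.2 v z) ?_ (Primrec.list_length.comp .snd)
  refine PrimrecRel.exists_lt_comp (R := fun v (q : ℕ × ℕ × List A) =>
    Branches q.2.1 q.2.2 v q.1) ?_ (Primrec.list_length.comp (Primrec.snd.comp .snd))
  exact primrecPred_branches.comp (.pair (.comp .fst (.comp .snd .snd))
    (.pair (.comp .snd (.comp .snd .snd)) (.pair .fst (.comp .fst .snd))))

theorem Primrec.codingState : Primrec₂ (codingState (A := A)) := by
  classical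
  have h : Primrec₂ fun (p : List A × ℕ) (q : ℕ × ℕ × ℕ) =>
      if HasBranch q.2.2 (p.1.take (q.1 + 1)) then (q.2.1 + 1, q.1 + 1) else q.2 := by
    refine Primrec.ite (primrecRel_hasBranch.comp (Primrec.snd.comp (Primrec.snd.comp .snd))
      (Primrec.list_take.comp (Primrec.succ.comp (Primrec.fst.comp .snd))
        (Primrec.fst.comp .fst))) (.pair (Primrec.succ.comp (.comp .fst (.comp .snd .snd)))
        (Primrec.succ.comp (Primrec.fst.comp .snd))) (Primrec.snd.comp .snd)
  refine (Primrec.nat_rec' (f := fun p : List A × ℕ => p.2) (g := fun _ => (0, 0)) .snd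
    (.const _) h).of_eq fun p => ?_
  obtain ⟨w, n⟩ := p
  induction n with
  | zero => rfl
  | succ n ih =>
    simp only at ih ⊢
    rw [ih, _root_.codingState]

theorem Primrec.letterBit [DecidableEq A] [Inhabited A] (l : List A) :
    Primrec fun p : List A × ℕ × ℕ => letterBit l p.1 p.2.1 p.2.2 := by
  have hz : Primrec fun p : List A × ℕ × ℕ => p.2.2 := .comp .snd .snd
  have hv : Primrec fun p : List A × ℕ × ℕ => p.2.1 := .comp .fst .snd
  refine PrimrecRel.decide (R := fun a b : ℕ => a < b) Primrec.nat_lt |>.comp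
    (Primrec.list_idxOf₁ l |>.comp (Primrec.option_getD_default.comp
      (Primrec.list_getElem?.comp .fst hz)))
    (Primrec.list_idxOf₁ l |>.comp (Primrec.option_getD_default.comp
      (Primrec.list_getElem?.comp .fst (Primrec.cellAdd.comp hv hz))))

/-- All words of a given length. -/
def allWords (l : List A) : ℕ → List (List A)
  | 0 => [[]]
  | n + 1 => (allWords l n).flatMap fun w => l.map fun a => w ++ [a]

omit [Primcodable A] in
theorem mem_allWords {l : List A} (hl : ∀ a, a ∈ l) (n : ℕ) (w : List A) :
    w ∈ allWords l n ↔ w.length = n := by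
  induction n generalizing w with
  | zero => simp [allWords]
  | succ n ih =>
    simp only [allWords, List.mem_flatMap, ih, List.mem_map, hl, true_and]
    constructor
    · rintro ⟨u, rfl, a, rfl⟩
      simp
    · intro h
      have hne : w ≠ [] := by
        rintro rfl
        simp at h
      exact ⟨w.dropLast, by simp [h], w.getLast hne, List.dropLast_append_getLast hne⟩

theorem Primrec.allWords (l : List A) : Primrec (allWords l) := by
  refine (Primrec.nat_rec₁ [[]] (f := fun _ (L : List (List A)) =>
    L.flatMap fun w => l.map fun a => w ++ [a]) ?_).of_eq fun n => ?_
  · exact Primrec.list_flatMap .snd (Primrec.list_map (.const l)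
      (Primrec.list_concat.comp (Primrec.snd.comp .fst) .snd))
  · induction n with
    | zero => rfl
    | succ n ih => rw [_root_.allWords, ← ih]

theorem PrimrecRel.exists_re {R : α → ℕ → Prop} (hR : PrimrecRel R) :
    REPred fun a => ∃ n, R a n := by
  classical
  have h : Partrec fun a => Nat.rfind fun n => Part.some (decide (R a n)) :=
    Partrec.rfind (PrimrecRel.decide hR).to_comp.partrec
  exact h.dom_re.of_eq fun a => Nat.rfind_dom'.trans (by simp)

/-- Each level has finitely many words, so only the level has to be searched for. -/
theorem rePred_empties [Finite A] {B : List A → Prop} (hB : PrimrecPred B) :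
    REPred (Empties B) := by
  cases nonempty_fintype A
  have hl : ∀ a, a ∈ (Finset.univ : Finset A).toList := by simp
  have h : PrimrecRel fun (S : List (List A)) m =>
      ∀ w ∈ allWords (Finset.univ : Finset A).toList m, Bad B S w :=
    PrimrecRel.forall_mem_comp (R := fun w (p : List (List A) × ℕ) => Bad B p.1 w)
      ((primrecRel_bad hB).comp (Primrec.fst.comp .snd) .fst) ((Primrec.allWords _).comp .snd)
  refine h.exists_re.of_eq fun S => ?_
  simp only [mem_allWords hl]
  rfl

theorem REPred.exists_code {p : α → Prop} (hp : REPred p) : ∃ c : Nat.Partrec.Code,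
    ∀ n, (c.eval n).Dom ↔ ∃ a, decode n = some a ∧ p a := by
  obtain ⟨c, hc⟩ := Nat.Partrec.Code.exists_code.1 hp
  refine ⟨c, fun n => ?_⟩
  rw [hc]
  rcases e : (decode n : Option α) with - | a <;> simp [e, Part.assert]

open Classical in
theorem REPred.computableIn_decide {O : Set (ℕ →. ℕ)} (hO : ComputableIn O haltingProblem)
    {p : α → Prop} (hp : REPred p) : ComputableIn O fun a => decide (p a) := by
  obtain ⟨c, hc⟩ := hp.exists_code
  refine (hO.comp_primrec (.pair (.const c) (.encode : Primrec fun a : α => encode a))).of_eq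
    fun a => ?_
  rw [haltingProblem]
  refine decide_eq_decide.2 ((hc _).trans ?_)
  simp [encodek]

end Primrec

/-! ### Computing the coded point from the sequence, and the sequence from the point. -/

section Relative

open Classical

variable {A : Type*} [Primcodable A] [Finite A] {B : List A → Prop} {O : Set (ℕ →. ℕ)}

theorem computableIn_forbiddenWords (hO : ComputableIn O haltingProblem) (hB : PrimrecPred B) :
    ComputableIn O (forbiddenWords B) := by
  have hE := (rePred_empties hB).computableIn_decide hO
  have hu : Primrec fun q : ℕ × ℕ × List (List A) =>
      ((decode q.2.1 : Option (List A)).getD []) :: q.2.2 :=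
    Primrec.list_cons.comp (Primrec.option_getD.comp
      (Primrec.decode.comp (Primrec.fst.comp .snd)) (.const [])) (Primrec.snd.comp .snd)
  have h : ComputableIn₂ O fun (_ : ℕ) (q : ℕ × List (List A)) =>
      bif decide (Empties B (((decode q.1 : Option (List A)).getD []) :: q.2)) then q.2
      else ((decode q.1 : Option (List A)).getD []) :: q.2 :=
    (hE.comp_primrec hu).cond (Primrec.snd.comp Primrec.snd).computableIn hu.computableIn
  refine (ComputableIn.nat_rec (.id : ComputableIn O (id : ℕ → ℕ)) (.const []) h).of_eq
    fun n => ?_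
  induction n with
  | zero => rfl
  | succ n ih =>
    simp only [id] at ih ⊢
    rw [ih, forbiddenWords, Bool.cond_decide]

theorem computableIn_inLanguage (hO : ComputableIn O haltingProblem) (hB : PrimrecPred B) :
    ComputableIn O fun u : List A => decide (InLanguage B u) :=
  ((rePred_empties hB).computableIn_decide hO).comp
    (Primrec.list_cons.comp_computableIn .id
      ((computableIn_forbiddenWords hO hB).comp_primrec .encode))

omit [Finite A] in
theorem computableIn_find? {p : List A → A → Bool}
    (hp : ∀ a, ComputableIn O fun w => p w a) (l : List A) :
    ComputableIn O fun w => l.find? (p w) := by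
  induction l with
  | nil => exact .const none
  | cons a l ih =>
    refine ((hp a).cond (.const (some a)) ih).of_eq fun w => ?_
    rw [List.find?_cons]
    cases p w a <;> rfl

theorem computableIn_greedyLetter [Inhabited A] (hO : ComputableIn O haltingProblem)
    (hB : PrimrecPred B) (l : List A) :
    ComputableIn O fun q : Bool × List A => greedyLetter B l q.1 q.2 := by
  have h := computableIn_find? (p := fun w a => decide (InLanguage B (w ++ [a]))) fun a =>
    (computableIn_inLanguage hO hB).comp_primrec (Primrec.list_concat.comp .id (.const a))
  refine (Primrec.option_getD_default.comp_computableIn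
    (ComputableIn.cond (.fst : ComputableIn O (Prod.fst : Bool × List A → Bool))
      ((h l).comp .snd) ((h l.reverse).comp .snd))).of_eq fun q => ?_
  rw [greedyLetter]
  cases q.1 <;> rfl

theorem computableIn_codingSeq [Inhabited A] (hO : ComputableIn O haltingProblem)
    (hB : PrimrecPred B) (l : List A) {s : ℕ → Bool} (hs : ComputableIn O s) :
    ComputableIn O (codingSeq B l s) := by
  have hg : ComputableIn O fun q : ℕ × List A =>
      greedyLetter B l (s (codingState q.2 q.1).1) q.2 := by
    have h1 : Primrec fun q : ℕ × List A => (codingState q.2 q.1).1 :=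
      Primrec.fst.comp (Primrec.codingState.comp .snd .fst)
    have h2 : ComputableIn O fun q : ℕ × List A => (s (codingState q.2 q.1).1, q.2) :=
      (hs.comp_primrec h1).pair .snd
    have h3 := (computableIn_greedyLetter hO hB l).comp h2
    exact h3
  have h : ComputableIn₂ O fun (_ : ℕ) (q : ℕ × List A) =>
      q.2 ++ [greedyLetter B l (s (codingState q.2 q.1).1) q.2] :=
    Primrec.list_concat.comp_computableIn (Primrec.snd.comp .snd).computableIn
      (hg.comp_primrec .snd)
  have hw : ComputableIn O (codingWord B l s) := by
    refine (ComputableIn.nat_rec (.id : ComputableIn O (id : ℕ → ℕ)) (.const []) h).of_eq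
      fun n => ?_
    induction n with
    | zero => rfl
    | succ n ih =>
      simp only [id] at ih ⊢
      rw [ih, codingWord]
  exact hg.comp (.pair .id hw)

omit [Finite A] in
theorem computableIn_initial {y : ℕ → A} (hy : ComputableIn O y) :
    ComputableIn O (initial y) := by
  have h : ComputableIn₂ O fun (_ : ℕ) (q : ℕ × List A) => q.2 ++ [y q.1] :=
    Primrec.list_concat.comp_computableIn (Primrec.snd.comp .snd).computableIn
      (hy.comp_primrec (Primrec.fst.comp .snd))
  refine (ComputableIn.nat_rec (.id : ComputableIn O (id : ℕ → ℕ)) (.const []) h).of_eq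
    fun n => ?_
  induction n with
  | zero => rfl
  | succ n ih =>
    simp only [id] at ih ⊢
    rw [ih, initial_succ]

/-- Search for a prefix in the state of bit `j` together with a branching pair, and read off the
comparison. The language is not consulted, so `0'` is not needed as an oracle. -/
theorem computableIn_of_codingSeq [Inhabited A] (hB : ShiftTree B) {l : List A}
    (hl : ∀ a, a ∈ l) (hn : l.Nodup) {s : ℕ → Bool}
    (hc : ¬ Computable fun p : ℤ × ℤ => codingSeq B l s (encode p))
    (hy : ComputableIn O (codingSeq B l s)) : ComputableIn O s := by
  set y := codingSeq B l s with hy_def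
  -- The number `c` codes the triple of `m`, `v` and `z`.
  let p : ℕ → ℕ → Option Bool := fun j c =>
    bif decide ((codingState (initial y (c.unpair.1 + 1)) c.unpair.1).1 = j) &&
        decide (Branches (codingState (initial y (c.unpair.1 + 1)) c.unpair.1).2
          (initial y (c.unpair.1 + 1)) c.unpair.2.unpair.1 c.unpair.2.unpair.2)
    then some (letterBit l (initial y (c.unpair.1 + 1)) c.unpair.2.unpair.1 c.unpair.2.unpair.2)
    else none
  have hst : ∀ m, codingState (initial y (m + 1)) m = codingState (initial y m) m := fun m =>
    codingState_congr (by rw [take_initial y m.le_succ, take_initial y le_rfl])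
  have hp : ComputableIn₂ O p := by
    have hm : Primrec fun q : ℕ × ℕ => q.2.unpair.1 := .comp .fst (.comp .unpair .snd)
    have hr : Primrec fun q : ℕ × ℕ => q.2.unpair.2.unpair :=
      .comp .unpair (.comp .snd (.comp .unpair .snd))
    have hi : ComputableIn O fun q : ℕ × ℕ => initial y (q.2.unpair.1 + 1) :=
      (computableIn_initial hy).comp_primrec (Primrec.succ.comp hm)
    have hs : ComputableIn O fun q : ℕ × ℕ =>
        codingState (initial y (q.2.unpair.1 + 1)) q.2.unpair.1 :=
      Primrec.codingState.comp_computableIn hi hm.computableIn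
    have hvz : ComputableIn O fun q : ℕ × ℕ => (initial y (q.2.unpair.1 + 1),
        q.2.unpair.2.unpair.1, q.2.unpair.2.unpair.2) :=
      hi.pair ((Primrec.fst.comp hr).pair (Primrec.snd.comp hr)).computableIn
    have h1 : ComputableIn O fun q : ℕ × ℕ =>
        decide ((codingState (initial y (q.2.unpair.1 + 1)) q.2.unpair.1).1 = q.1) :=
      (PrimrecRel.decide Primrec.eq).comp_computableIn (Primrec.fst.comp_computableIn hs) .fst
    have h2 : ComputableIn O fun q : ℕ × ℕ =>
        decide (Branches (codingState (initial y (q.2.unpair.1 + 1)) q.2.unpair.1).2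
          (initial y (q.2.unpair.1 + 1)) q.2.unpair.2.unpair.1 q.2.unpair.2.unpair.2) := by
      have := (PrimrecPred.decide primrecPred_branches).comp_computableIn
        ((Primrec.snd.comp_computableIn hs).pair hvz)
      exact this
    have h3 : ComputableIn O fun q : ℕ × ℕ => letterBit l (initial y (q.2.unpair.1 + 1))
        q.2.unpair.2.unpair.1 q.2.unpair.2.unpair.2 := by
      have := (Primrec.letterBit l).comp_computableIn hvz
      exact this
    exact .cond (Primrec.and.comp_computableIn h1 h2)
      (Primrec.option_some.comp_computableIn h3) (.const none)
  have hM : InMinimal B y := inMinimal_codingSeq hB hl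
  refine ComputableIn.of_search hp (fun j => ?_) fun j c b h => ?_
  · obtain ⟨m, h1, z, -, v, -, h2⟩ := exists_codingState hB hM hc j
    exact ⟨Nat.pair m (Nat.pair v z), by simp [p, hst, h1, h2]⟩
  · simp only [p, hst, Bool.cond_eq_ite, Bool.and_eq_true, decide_eq_true_eq] at h
    split_ifs at h with h1
    obtain rfl := Option.some.inj h
    rw [letterBit_codingSeq hB hl hn h1.2, h1.1]

end Relative

/-! ### A primitive recursive tree for the subshift. -/

section Tree

variable {A : Type*} [Primcodable A]

/-- A pattern listed in a stage of the enumeration `c` up to `w.length` occurs in `w`. -/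
def ForbiddenBy (c : Nat.Partrec.Code) (w : List A) : Prop :=
  ∃ k < w.length, ∃ e < w.length, ∃ v < w.length, (c.evaln k e).isSome = true ∧
    ∀ q ∈ ((decode e : Option (List ((ℤ × ℤ) × A))).getD []),
      w[encode (ofNat (ℤ × ℤ) v + q.1)]? = some q.2

theorem primrecPred_forbiddenBy (c : Nat.Partrec.Code) :
    PrimrecPred (ForbiddenBy (A := A) c) := by
  refine PrimrecRel.exists_lt_comp (R := fun k (w : List A) => ∃ e < w.length, ∃ v < w.length,
    (c.evaln k e).isSome = true ∧ ∀ q ∈ ((decode e : Option (List ((ℤ × ℤ) × A))).getD []),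
      w[encode (ofNat (ℤ × ℤ) v + q.1)]? = some q.2) ?_ .list_length
  refine PrimrecRel.exists_lt_comp (R := fun e (p : ℕ × List A) => ∃ v < p.2.length,
    (c.evaln p.1 e).isSome = true ∧ ∀ q ∈ ((decode e : Option (List ((ℤ × ℤ) × A))).getD []),
      p.2[encode (ofNat (ℤ × ℤ) v + q.1)]? = some q.2) ?_ (Primrec.list_length.comp .snd)
  refine PrimrecRel.exists_lt_comp (R := fun v (p : ℕ × ℕ × List A) =>
    (c.evaln p.2.1 p.1).isSome = true ∧
      ∀ q ∈ ((decode p.1 : Option (List ((ℤ × ℤ) × A))).getD []),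
      p.2.2[encode (ofNat (ℤ × ℤ) v + q.1)]? = some q.2) ?_
      (Primrec.list_length.comp (Primrec.snd.comp .snd))
  have he : Primrec fun p : ℕ × ℕ × ℕ × List A => p.2.1 := .comp .fst .snd
  have hk : Primrec fun p : ℕ × ℕ × ℕ × List A => p.2.2.1 := .comp .fst (.comp .snd .snd)
  have hw : Primrec fun p : ℕ × ℕ × ℕ × List A => p.2.2.2 := .comp .snd (.comp .snd .snd)
  refine PrimrecPred.and ?_ ?_
  · exact Primrec.eq.comp (Primrec.option_isSome.comp (Nat.Partrec.Code.primrec_evaln.comp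
      (.pair (.pair hk (.const c)) he))) (.const true)
  · refine PrimrecRel.forall_mem_comp (R := fun (q : (ℤ × ℤ) × A) (p : ℕ × ℕ × ℕ × List A) =>
      p.2.2.2[encode (ofNat (ℤ × ℤ) p.1 + q.1)]? = some q.2) ?_
      (Primrec.option_getD.comp (Primrec.decode.comp he) (.const []))
    exact Primrec.eq.comp (Primrec.list_getElem?.comp (hw.comp .snd) (Primrec.encode.comp
      (Primrec.prodInt_add.comp ((Primrec.ofNat _).comp (Primrec.fst.comp .snd))
        (Primrec.fst.comp .fst)))) (Primrec.option_some.comp (Primrec.snd.comp .fst))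

theorem ForbiddenBy.mono {c : Nat.Partrec.Code} {w w' : List A} (hw : w <+: w')
    (h : ForbiddenBy c w) : ForbiddenBy c w' := by
  obtain ⟨k, hk, e, he, v, hv, h1, h2⟩ := h
  have hl := hw.length_le
  refine ⟨k, hk.trans_le hl, e, he.trans_le hl, v, hv.trans_le hl, h1, fun q hq => ?_⟩
  obtain ⟨h3, h4⟩ := List.getElem?_eq_some_iff.1 (h2 q hq)
  rw [← h4, hw.getElem h3, List.getElem?_eq_getElem]

theorem not_forbiddenBy_iff {P : List ((ℤ × ℤ) × A) → Prop} {c : Nat.Partrec.Code}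
    (hc : ∀ n, (c.eval n).Dom ↔ ∃ l, decode n = some l ∧ P l) {y : ℕ → A} :
    (∀ m, ¬ ForbiddenBy c (initial y m)) ↔
      ∀ l, P l → ∀ g, ¬ ∀ q ∈ l, y (encode (g + q.1 : ℤ × ℤ)) = q.2 := by
  constructor
  · intro h l hl g hg
    obtain ⟨b, hb⟩ := Part.dom_iff_mem.1 ((hc (encode l)).2 ⟨l, encodek l, hl⟩)
    obtain ⟨k, hk⟩ := Nat.Partrec.Code.evaln_complete.1 hb
    -- A length exceeding the stage, both codes, and every cell of the translated pattern.
    set M := k + encode l + encode g + 1 + (l.map fun q => encode (g + q.1) + 1).sum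
    have hM : ∀ q ∈ l, encode (g + q.1) < M := fun q hq => by
      have := List.le_sum_of_mem (List.mem_map_of_mem (f := fun q => encode (g + q.1) + 1) hq)
      omega
    refine h M ⟨k, ?_, encode l, ?_, encode g, ?_, Option.isSome_iff_exists.2 ⟨b, hk⟩, ?_⟩
    · rw [length_initial]; omega
    · rw [length_initial]; omega
    · rw [length_initial]; omega
    · intro q hq
      rw [encodek, Option.getD_some] at hq
      rw [ofNat_encode, getElem?_initial (hM q hq), hg q hq]
  · rintro h m ⟨k, -, e, -, v, -, h1, h2⟩
    obtain ⟨b, hb⟩ := Option.isSome_iff_exists.1 h1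
    obtain ⟨l, hl, hP⟩ := (hc e).1 (Part.dom_iff_mem.2
      ⟨b, Nat.Partrec.Code.evaln_sound hb⟩)
    rw [hl, Option.getD_some] at h2
    exact h l hP (ofNat _ v) fun q hq => (getElem?_initial_eq_some.1 (h2 q hq)).2

omit [Primcodable A] in
theorem EnumeratesPattern.forall_iff [Inhabited A] {l : List ((ℤ × ℤ) × A)}
    {p : Pattern A (ℤ × ℤ)} (h : EnumeratesPattern l p) (x : ℤ × ℤ → A) (g : ℤ × ℤ) :
    (∀ q ∈ l, x (g + q.1) = q.2) ↔ p.occursInAt x g := by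
  constructor
  · intro H z hz
    exact H (z, p.config z) ((h _ _).2 ⟨hz, rfl⟩)
  · rintro H ⟨z, a⟩ hq
    obtain ⟨hz, rfl⟩ := (h _ _).1 hq
    exact H z hz

/-- A list that enumerates a given pattern. -/
noncomputable def enumerationOf [Inhabited A] (p : Pattern A (ℤ × ℤ)) : List ((ℤ × ℤ) × A) :=
  p.support.toList.map fun z => (z, p.config z)

omit [Primcodable A] in
theorem enumeratesPattern_enumerationOf [Inhabited A] (p : Pattern A (ℤ × ℤ)) :
    EnumeratesPattern (enumerationOf p) p := fun z a => by
  simp only [enumerationOf, List.mem_map, Finset.mem_toList, Prod.mk.injEq]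
  constructor
  · rintro ⟨z, hz, rfl, rfl⟩
    exact ⟨hz, rfl⟩
  · rintro ⟨hz, rfl⟩
    exact ⟨z, hz, rfl, rfl⟩

/-- Effective subshifts and subshifts of finite type are both given by a computably enumerable
family of lists. -/
theorem exists_rePred_lists [Inhabited A] [TopologicalSpace A] [DiscreteTopology A]
    {X : Subshift A (ℤ × ℤ)} (hX : IsEffectiveSubshift X ∨ IsSFT X) :
    ∃ P : List ((ℤ × ℤ) × A) → Prop, REPred P ∧
      ∀ x, x ∈ X.carrier ↔ ∀ l, P l → ∀ g, ¬ ∀ q ∈ l, x (g + q.1) = q.2 := by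
  classical
  rcases hX with ⟨F, hF, rfl⟩ | ⟨F, hF, rfl⟩
  · refine ⟨_, hF, fun x => ⟨?_, fun h p hp g hg => ?_⟩⟩
    · rintro h l ⟨p, hp, hl⟩ g hg
      exact h p hp g ((hl.forall_iff x g).1 hg)
    · exact h _ ⟨p, hp, enumeratesPattern_enumerationOf p⟩ g
        (((enumeratesPattern_enumerationOf p).forall_iff x g).2 hg)
  · refine ⟨fun l => ∃ p ∈ F, l = enumerationOf p, ?_, fun x => ⟨?_, fun h p hp g hg => ?_⟩⟩
    · have h : PrimrecPred fun l : List ((ℤ × ℤ) × A) =>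
          ∃ l' ∈ hF.toFinset.toList.map enumerationOf, l' = l :=
        PrimrecRel.exists_mem_comp (R := fun l' l => l' = l) Primrec.eq (.const _)
      refine h.computablePred.to_re.of_eq fun l => ?_
      simp [eq_comm]
    · rintro h l ⟨p, hp, rfl⟩ g hg
      exact h p hp g (((enumeratesPattern_enumerationOf p).forall_iff x g).1 hg)
    · exact h _ ⟨p, hp, rfl⟩ g (((enumeratesPattern_enumerationOf p).forall_iff x g).2 hg)

/-- Bounding the stage of the enumeration by the length of the word makes the tree primitive
recursive: a pattern enumerated late excludes only longer words, with the same infinite branches. -/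
theorem exists_shiftTree [Inhabited A] [TopologicalSpace A] [DiscreteTopology A]
    {X : Subshift A (ℤ × ℤ)} (hne : X.carrier.Nonempty)
    (hX : IsEffectiveSubshift X ∨ IsSFT X) :
    ∃ B : List A → Prop, PrimrecPred B ∧ ShiftTree B ∧
      ∀ y : ℕ → A, (∀ m, ¬ B (initial y m)) ↔ (fun p => y (encode p)) ∈ X.carrier := by
  obtain ⟨P, hP, hXP⟩ := exists_rePred_lists hX
  obtain ⟨c, hc⟩ := hP.exists_code
  have key : ∀ y : ℕ → A, (∀ m, ¬ ForbiddenBy c (initial y m)) ↔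
      (fun p => y (encode p)) ∈ X.carrier := fun y => by
    rw [not_forbiddenBy_iff hc, hXP]
  refine ⟨ForbiddenBy c, primrecPred_forbiddenBy c, ⟨fun w w' h => .mono h, fun y v => ?_, ?_⟩,
    key⟩
  · rw [key, key]
    intro h
    convert X.mapsTo (ofNat (ℤ × ℤ) v) h using 1
    funext p
    simp only [shiftSeq, cellAdd, ofNat_encode, shift_apply]
  · obtain ⟨x, hx⟩ := hne
    refine ⟨fun n => x (ofNat _ n), (key _).2 ?_⟩
    simpa only [ofNat_encode] using hx

end Tree

/-! ### Turing degrees and relative computability. -/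

section Degree

variable {α γ δ : Type*} [Denumerable α] [Denumerable γ] [Encodable δ]

theorem computableIn_iff_ofNat {σ : Type*} [Primcodable σ] {O : Set (ℕ →. ℕ)} {f : α → σ} :
    ComputableIn O f ↔ ComputableIn O fun n : ℕ => encode (f (ofNat α n)) := by
  rw [ComputableIn.encode_iff]
  exact ⟨fun h => h.comp_primrec (.ofNat _),
    fun h => (h.comp_primrec .encode).of_eq fun a => by rw [ofNat_encode]⟩

theorem turingDegree_le_iff {σ : Type*} [Primcodable σ] {f : α → σ} {g : γ → δ} :
    turingDegree f ≤ turingDegree g ↔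
      ComputableIn {fun n : ℕ => Part.some (encode (g (ofNat γ n)))} f :=
  Iff.trans Iff.rfl computableIn_iff_ofNat.symm

theorem computableIn_turingDegree {σ : Type*} [Primcodable σ] (f : α → σ) :
    ComputableIn {fun n : ℕ => Part.some (encode (f (ofNat α n)))} f :=
  turingDegree_le_iff.1 le_rfl

end Degree

theorem mainTheorem10 {A : Type*} [Finite A] [Inhabited A] [Primcodable A]
    [TopologicalSpace A] [DiscreteTopology A]
    (X : Subshift A (ℤ × ℤ)) (hne : X.carrier.Nonempty)
    (hX : IsEffectiveSubshift X ∨ IsSFT X)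
    (hnc : ∀ x ∈ X.carrier, ¬ Computable x)
    (s : ℕ → Bool) (hs : turingDegree haltingProblem ≤ turingDegree s) :
    ∃ x ∈ X.carrier, turingDegree x = turingDegree s := by
  classical
  cases nonempty_fintype A
  obtain ⟨B, hBp, hB, hBX⟩ := exists_shiftTree hne hX
  set l := (Finset.univ : Finset A).toList
  have hl : ∀ a, a ∈ l := by simp [l]
  have hn : l.Nodup := Finset.nodup_toList _
  set y := codingSeq B l s with hy
  have hyX : (fun p => y (encode p)) ∈ X.carrier :=
    (hBX y).1 fun m h => inMinimal_codingSeq (s := s) hB hl 0 m (.inl h)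
  refine ⟨_, hyX, le_antisymm (turingDegree_le_iff.2 ?_) (turingDegree_le_iff.2 ?_)⟩
  · exact (computableIn_codingSeq (turingDegree_le_iff.1 hs) hBp l
      (computableIn_turingDegree s)).comp_primrec .encode
  · refine computableIn_of_codingSeq hB hl hn (hnc _ hyX) (ComputableIn.of_eq
      ((computableIn_turingDegree fun p : ℤ × ℤ => y (encode p)).comp_primrec (.ofNat _))
      fun n => ?_)
    simp only [encode_ofNat, hy]
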